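/- Let $p \in [1,\infty)$. An $L^p$-operator algebra is a complex Banach algebra $A$ (not necessarily unital) that has an isometric representation on $L^p(\mu_0)$ for some measure $\mu_0$. Let $A$ be an $L^p$-operator algebra with a contractive approximate identity, that is, a net $(e_\lambda)$ with $\|e_\lambda\|\le 1$ and $\|ae_\lambda-a\|\to 0$, $\|e_\lambda a-a\|\to 0$ for all $a\in A$. Let $G$ be a second countable locally compact (Hausdorff) group with left Haar measure $\nu$, and let $\alpha$ be an isometric action of $G$ on $A$: each $\alpha_g$ is an isometric algebra automorphism of $A$, $\alpha_{gh}=\alpha_g\alpha_h$, and $g\mapsto\alpha_g(a)$ is continuous for every $a\in A$. Let $L^1(G,A,\alpha)$ be the Banach space $L^1(G,\nu;A)$ with the product $$(x*y)(g)=\int_G x(h)\,\alpha_h\big(y(h^{-1}g)\big)\,d\nu(h).$$ A contractive covariant representation of $(G,A,\alpha)$ on $L^p(\mu)$ is a pair $(\rho,u)$ of a homomorphism of algebras $\rho\colon A\to\mathcal L(L^p(\mu))$ with $\|\rho(a)\|\le\|a\|$ for all $a \in A$, and a group homomorphism $u$ from $G$ to the invertible elements of $\mathcal L(L^p(\mu))$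 with $\|u_g\|\le 1$ for all $g \in G$ and $g\mapsto u_g\xi$ continuous for each $\xi \in L^p(\mu)$, such that $\rho(\alpha_g(a))=u_g\rho(a)u_g^{-1}$ for all $g \in G$, $a \in A$. It is $\sigma$-finite if $\mu$ is, and nondegenerate if the vectors $\rho(a)\xi$ span a dense subspace of $L^p(\mu)$. For $x\in L^1(G,A,\alpha)$ put $$\big((\rho\rtimes u)(x)\big)\xi=\int_G\rho(x(g))u_g\xi\,d\nu(g),\qquad \|x\|_\rtimes=\sup_{(\rho,u)}\|(\rho\rtimes u)(x)\|,$$ the supremum being over all $\sigma$-finite nondegenerate contractive covariant representations $(\rho,u)$ of $(G,A,\alpha)$ on $L^p$-spaces. Let $\mu$ be a $\sigma$-finite measure and let $\pi\colon L^1(G,A,\alpha)\to\mathcal L(L^p(\mu))$ be a linear and multiplicative map with $\|\pi(x)\|\le\|x\|_1$ for all $x$, which is nondegenerate: the vectors $\pi(x)\xi$ span a dense subspace of $L^p(\mu)$. Then $\|\pi(x)\|\le\|x\|_\rtimes$ for all $x\in L^1(G,A,\alpha)$. -/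

import Mathlib

open MeasureTheory Filter Topology

universe w w₀ u v

noncomputable section

namespace LpCrossed

/-- A (not necessarily unital) Banach algebra `A` is an `L^p`-operator algebra if it has an
isometric representation on `L^p(μ)` for some measure space. -/
def IsLpOperatorAlgebra (p : ENNReal) [Fact (1 ≤ p)] (A : Type v)
    [NonUnitalNormedRing A] [NormedSpace ℂ A] : Prop :=
  ∃ (Ω : Type w) (_ : MeasurableSpace Ω) (μ : Measure Ω)
    (ρ : A →ₙₐ[ℂ] (Lp ℂ p μ →L[ℂ] Lp ℂ p μ)), ∀ a, ‖ρ a‖ = ‖a‖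

/-- Existence of a two-sided approximate identity bounded by one, with nets replaced by
proper filters. -/
def HasContractiveApproxIdentity (A : Type*) [NonUnitalNormedRing A] : Prop :=
  ∃ l : Filter A, l.IsApproximateUnit ∧ ∀ᶠ e in l, ‖e‖ ≤ 1

/-- A strongly continuous action of a topological group `G` on a normed algebra `A` by isometric
algebra automorphisms (each `toFun g` is bijective, with inverse `toFun g⁻¹`). -/
structure IsometricAction (G A : Type*) [Group G] [TopologicalSpace G]
    [NonUnitalNormedRing A] [NormedSpace ℂ A] where
  toFun : G → A →ₙₐ[ℂ] A
  map_one : ∀ a, toFun 1 a = a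
  map_mul : ∀ g h a, toFun (g * h) a = toFun g (toFun h a)
  norm_map : ∀ g a, ‖toFun g a‖ = ‖a‖
  continuous_orbit : ∀ a, Continuous fun g => toFun g a

instance {G A : Type*} [Group G] [TopologicalSpace G]
    [NonUnitalNormedRing A] [NormedSpace ℂ A] :
    CoeFun (IsometricAction G A) fun _ => G → A →ₙₐ[ℂ] A := ⟨IsometricAction.toFun⟩

theorem IsometricAction.continuous_uncurry {G A : Type*} [Group G] [TopologicalSpace G]
    [NonUnitalNormedRing A] [NormedSpace ℂ A] (α : IsometricAction G A) :
    Continuous fun q : G × A => α q.1 q.2 := by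
  rw [continuous_iff_continuousAt]
  rintro ⟨g, a⟩
  have h1 : Tendsto (fun q : G × A => α q.1 (q.2 - a)) (𝓝 (g, a)) (𝓝 0) := by
    rw [tendsto_zero_iff_norm_tendsto_zero]
    simp only [α.norm_map]
    have : Continuous fun q : G × A => ‖q.2 - a‖ := by fun_prop
    simpa using this.tendsto (g, a)
  have h2 : Tendsto (fun q : G × A => α q.1 a) (𝓝 (g, a)) (𝓝 (α g a)) :=
    ((α.continuous_orbit a).comp continuous_fst).tendsto (g, a)
  have h3 := h1.add h2
  simp only [map_sub, sub_add_cancel, zero_add] at h3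
  exact h3

section Convolution

variable {G A : Type*} [Group G] [TopologicalSpace G] [IsTopologicalGroup G]
  [LocallyCompactSpace G] [SecondCountableTopology G] [T2Space G]
  [MeasurableSpace G] [BorelSpace G]
  [NonUnitalNormedRing A] [NormedSpace ℂ A]

theorem integrable_twistedIntegrand (α : IsometricAction G A)
    (ν : Measure G) [ν.IsHaarMeasure] (x y : Lp A 1 ν) :
    Integrable (fun q : G × G => x q.2 * α q.2 (y (q.2⁻¹ * q.1))) (ν.prod ν) := by
  have hx : Integrable x ν := L1.integrable_coeFn x
  have hy : Integrable y ν := L1.integrable_coeFn y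
  have hH : Integrable (fun q : G × G => x q.1 * α q.1 (y q.2)) (ν.prod ν) := by
    have hm : AEStronglyMeasurable (fun q : G × G => x q.1 * α q.1 (y q.2)) (ν.prod ν) := by
      refine hx.aestronglyMeasurable.comp_fst.mul ?_
      have h1 : AEStronglyMeasurable (fun q : G × G => (q.1, y q.2)) (ν.prod ν) :=
        (measurable_fst.stronglyMeasurable.aestronglyMeasurable).prodMk
          hy.aestronglyMeasurable.comp_snd
      exact α.continuous_uncurry.comp_aestronglyMeasurable h1
    refine (hx.norm.mul_prod hy.norm).mono hm (Eventually.of_forall fun q => ?_)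
    refine (norm_mul_le _ _).trans ?_
    rw [α.norm_map]
    simp
  exact (measurePreserving_prod_inv_mul_swap ν ν).integrable_comp_of_integrable hH

/-- The product of `L^1(G, A, α)`: the twisted convolution
`(x * y)(g) = ∫ x(h) α_h(y(h⁻¹ g)) dν(h)` on `L^1(G, ν; A)`. -/
def twistedConv (α : IsometricAction G A) (ν : Measure G) [ν.IsHaarMeasure]
    (x y : Lp A 1 ν) : Lp A 1 ν :=
  (integrable_twistedIntegrand α ν x y).integral_prod_left.toL1
    (fun g => ∫ h, x h * α h (y (h⁻¹ * g)) ∂ν)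

theorem coeFn_twistedConv (α : IsometricAction G A) (ν : Measure G) [ν.IsHaarMeasure]
    (x y : Lp A 1 ν) :
    twistedConv α ν x y =ᵐ[ν] fun g => ∫ h, x h * α h (y (h⁻¹ * g)) ∂ν :=
  Integrable.coeFn_toL1 _

end Convolution

/-- A family of operators `T` on `E` is nondegenerate if the vectors `T i ξ` span a dense
subspace of `E`. -/
def IsNondegenerateFamily {ι E : Type*} [NormedAddCommGroup E] [NormedSpace ℂ E]
    (T : ι → E →L[ℂ] E) : Prop :=
  Dense (Submodule.span ℂ {η : E | ∃ i ξ, T i ξ = η} : Set E)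

/-- A covariant representation of `(G, A, α)` on a Banach space `E`. -/
structure CovariantRep {G A : Type*} [Group G] [TopologicalSpace G]
    [NonUnitalNormedRing A] [NormedSpace ℂ A] (α : IsometricAction G A)
    (E : Type*) [NormedAddCommGroup E] [NormedSpace ℂ E] where
  rep : A →ₙₐ[ℂ] (E →L[ℂ] E)
  continuous_rep : Continuous rep
  grp : G →* (E →L[ℂ] E)ˣ
  continuous_grp : ∀ ξ, Continuous fun g => (grp g : E →L[ℂ] E) ξ
  covariant : ∀ g a, rep (α g a) = (grp g : E →L[ℂ] E) * rep a * (↑(grp g)⁻¹ : E →L[ℂ] E)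

namespace CovariantRep

section

variable {G A : Type*} [Group G] [TopologicalSpace G]
  [NonUnitalNormedRing A] [NormedSpace ℂ A] {α : IsometricAction G A}
  {E : Type*} [NormedAddCommGroup E] [NormedSpace ℂ E]

/-- `(π, u)` is contractive if `‖π a‖ ≤ ‖a‖` and `‖u_g‖ ≤ 1` for all `a` and `g`. -/
def IsContractive (R : CovariantRep α E) : Prop :=
  (∀ a, ‖R.rep a‖ ≤ ‖a‖) ∧ ∀ g, ‖(R.grp g : E →L[ℂ] E)‖ ≤ 1

/-- `(π, u)` is nondegenerate if `π` is. -/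
def IsNondegenerate (R : CovariantRep α E) : Prop :=
  IsNondegenerateFamily fun a => R.rep a

theorem IsContractive.norm_apply_le {R : CovariantRep α E} (hR : R.IsContractive)
    (a : A) (g : G) (ξ : E) : ‖R.rep a ((R.grp g : E →L[ℂ] E) ξ)‖ ≤ ‖a‖ * ‖ξ‖ := by
  refine ((R.rep a).le_opNorm _).trans ?_
  refine mul_le_mul (hR.1 a) ?_ (norm_nonneg _) (norm_nonneg _)
  simpa using (R.grp g : E →L[ℂ] E).le_of_opNorm_le (hR.2 g) ξ

end

section

variable {G A : Type*} [Group G] [TopologicalSpace G] [SecondCountableTopology G]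
  [MeasurableSpace G] [BorelSpace G]
  [NonUnitalNormedRing A] [NormedSpace ℂ A] {α : IsometricAction G A}
  {E : Type*} [NormedAddCommGroup E] [NormedSpace ℂ E]

theorem IsContractive.integrable {R : CovariantRep α E} (hR : R.IsContractive)
    {ν : Measure G} (x : Lp A 1 ν) (ξ : E) :
    Integrable (fun g => R.rep (x g) ((R.grp g : E →L[ℂ] E) ξ)) ν := by
  have hx : Integrable x ν := L1.integrable_coeFn x
  refine (hx.norm.mul_const ‖ξ‖).mono ?_ (Eventually.of_forall fun g => ?_)
  · exact isBoundedBilinearMap_apply.continuous.comp_aestronglyMeasurable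
      ((R.continuous_rep.comp_aestronglyMeasurable hx.aestronglyMeasurable).prodMk
        (R.continuous_grp ξ).aestronglyMeasurable)
  · simpa using hR.norm_apply_le (x g) g ξ

/-- The integrated form `π ⋊ u` of a contractive covariant representation:
`((π ⋊ u) x) ξ = ∫ π(x(g)) u_g ξ dν(g)`. -/
def integrated (R : CovariantRep α E) (hR : R.IsContractive) (ν : Measure G) (x : Lp A 1 ν) :
    E →L[ℂ] E :=
  LinearMap.mkContinuous
    { toFun := fun ξ => ∫ g, R.rep (x g) ((R.grp g : E →L[ℂ] E) ξ) ∂ν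
      map_add' := fun ξ η => by
        simp only [map_add]
        exact integral_add (hR.integrable x ξ) (hR.integrable x η)
      map_smul' := fun c ξ => by
        simp only [map_smul, RingHom.id_apply]
        exact integral_smul c _ } ‖x‖ (fun ξ => by
    change ‖∫ g, R.rep (x g) ((R.grp g : E →L[ℂ] E) ξ) ∂ν‖ ≤ ‖x‖ * ‖ξ‖
    rw [L1.norm_eq_integral_norm, ← integral_mul_const]
    exact norm_integral_le_of_norm_le ((L1.integrable_coeFn x).norm.mul_const _)
      (Eventually.of_forall fun g => hR.norm_apply_le (x g) g ξ))

theorem integrated_apply (R : CovariantRep α E) (hR : R.IsContractive) (ν : Measure G)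
    (x : Lp A 1 ν) (ξ : E) :
    R.integrated hR ν x ξ = ∫ g, R.rep (x g) ((R.grp g : E →L[ℂ] E) ξ) ∂ν := rfl

theorem norm_integrated_le (R : CovariantRep α E) (hR : R.IsContractive) (ν : Measure G)
    (x : Lp A 1 ν) : ‖R.integrated hR ν x‖ ≤ ‖x‖ :=
  LinearMap.mkContinuous_norm_le _ (norm_nonneg _) _

end

end CovariantRep

section Norm

variable {G A : Type*} [Group G] [TopologicalSpace G] [SecondCountableTopology G]
  [MeasurableSpace G] [BorelSpace G]
  [NonUnitalNormedRing A] [NormedSpace ℂ A]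

/-- The numbers `‖(π ⋊ u) x‖`, where `(π, u)` runs over the `σ`-finite nondegenerate contractive
covariant representations of `(G, A, α)` on `L^p`-spaces. -/
def crossedNormSet (p : ENNReal) [Fact (1 ≤ p)] (α : IsometricAction G A) (ν : Measure G)
    (x : Lp A 1 ν) : Set ℝ :=
  {r | ∃ (Ω : Type w) (_ : MeasurableSpace Ω) (μ : Measure Ω) (_ : SigmaFinite μ)
    (R : CovariantRep α (Lp ℂ p μ)) (hR : R.IsContractive),
    R.IsNondegenerate ∧ r = ‖R.integrated hR ν x‖}

theorem bddAbove_crossedNormSet (p : ENNReal) [Fact (1 ≤ p)] (α : IsometricAction G A)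
    (ν : Measure G) (x : Lp A 1 ν) : BddAbove (crossedNormSet.{w} p α ν x) := by
  refine ⟨‖x‖, ?_⟩
  rintro r ⟨Ω, _, μ, _, R, hR, -, rfl⟩
  exact R.norm_integrated_le hR ν x

/-- The universal crossed product (semi)norm `‖x‖_⋊`, extended from `C_c(G, A, α)` to
`L^1(G, A, α)` by the same formula; it is bounded by the `L^1`-norm. -/
def crossedNorm (p : ENNReal) [Fact (1 ≤ p)] (α : IsometricAction G A) (ν : Measure G)
    (x : Lp A 1 ν) : ℝ :=
  sSup (crossedNormSet.{w} p α ν x)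

end Norm

end LpCrossed

end

/-! The representation `π` is itself the integrated form of a nondegenerate contractive covariant
representation on the same space, so `‖π x‖` is one of the numbers in the supremum. To recover the
pair, let `A` act on `L^1(G, A)` by pointwise left multiplication and `G` by twisted translation.
Both are contractive and commute with right convolution, so they are left centralizers. Since
`L^1(G, A, α)` has a contractive left approximate identity `e_i`, a centralizer `T` passes to `E` as
the strong limit of `π (T e_i)`, which sends `π x ξ` to `π (T x) ξ`
(`exists_extension_of_centralizer`). Density of these vectors transfers the algebraic identities and
covariance to `E` (`exists_covariantRep`). Finally `x * y` is the Bochner integral of `leftMul (x h)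
(translate h y)` (`twistedConv_eq_integral`). Applying `π` under the integral gives `π x (π y ξ) = ∫
ρ(x h) u_h (π y ξ)`, so the integrated form is `π`. -/

noncomputable section

namespace LpCrossed

namespace IsometricAction

variable {G A : Type*} [Group G] [TopologicalSpace G] [NonUnitalNormedRing A] [NormedSpace ℂ A]

/-- Each automorphism of an isometric action, as a linear isometry. -/
def linearIsometry (α : IsometricAction G A) (g : G) : A →ₗᵢ[ℂ] A where
  toFun := α g
  map_add' := map_add (α g)
  map_smul' := map_smul (α g)
  norm_map' := α.norm_map g

end IsometricAction

/-! ### Left multiplication by `A` on `L^1(G, A)` -/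

section Centralizers

variable {G A : Type*} [MeasurableSpace G]
  [NonUnitalNormedRing A] [NormedSpace ℂ A] [IsScalarTower ℂ A A] [SMulCommClass ℂ A A]

/-- Pointwise left multiplication by elements of `A` on `L^1(G, A)`. -/
def leftMul (ν : Measure G) : A →L[ℂ] Lp A 1 ν →L[ℂ] Lp A 1 ν :=
  (ContinuousLinearMap.mul ℂ A).compLpL₂ 1 ν

theorem coeFn_leftMul (ν : Measure G) (a : A) (x : Lp A 1 ν) :
    leftMul ν a x =ᵐ[ν] fun g => a * x g :=
  (ContinuousLinearMap.mul ℂ A a).coeFn_compLp x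

theorem norm_leftMul_le (ν : Measure G) (a : A) : ‖leftMul ν a‖ ≤ ‖a‖ :=
  ((ContinuousLinearMap.mul ℂ A a).norm_compLpL_le).trans
    (ContinuousLinearMap.opNorm_mul_apply_le ℂ A a)

theorem norm_leftMul_apply_le (ν : Measure G) (a : A) (x : Lp A 1 ν) :
    ‖leftMul ν a x‖ ≤ ‖a‖ * ‖x‖ :=
  (leftMul ν a).le_of_opNorm_le (norm_leftMul_le ν a) x

theorem leftMul_mul (ν : Measure G) (a b : A) (x : Lp A 1 ν) :
    leftMul ν (a * b) x = leftMul ν a (leftMul ν b x) := by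
  apply Lp.ext
  filter_upwards [coeFn_leftMul ν (a * b) x, coeFn_leftMul ν a (leftMul ν b x),
    coeFn_leftMul ν b x] with g h1 h2 h3
  rw [h1, h2, h3, mul_assoc]

/-- On indicators this is convergence in `A`. The bound `‖e‖ ≤ 1` makes the operators
equicontinuous, which carries it to `L^1` limits. -/
theorem tendsto_leftMul {ν : Measure G} {l : Filter A} (hl : l.IsApproximateUnit)
    (hb : ∀ᶠ e in l, ‖e‖ ≤ 1) (x : Lp A 1 ν) :
    Tendsto (fun e => leftMul ν e x) l (𝓝 x) := by
  induction x using Lp.induction (by simp : (1 : ENNReal) ≠ ⊤) with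
  | @indicatorConst c s hs hμs =>
    have key : ∀ e : A, leftMul ν e (indicatorConstLp 1 hs hμs.ne c) =
        indicatorConstLp 1 hs hμs.ne (e * c) := by
      intro e
      apply Lp.ext
      filter_upwards [coeFn_leftMul ν e (indicatorConstLp 1 hs hμs.ne c),
        indicatorConstLp_coeFn (p := 1) (hs := hs) (hμs := hμs.ne) (c := c),
        indicatorConstLp_coeFn (p := 1) (hs := hs) (hμs := hμs.ne) (c := e * c)] with g h1 h2 h3
      rw [h1, h2, h3]
      by_cases hg : g ∈ s <;> simp [hg]
    rw [Lp.simpleFunc.coe_indicatorConst]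
    simp only [key]
    rw [tendsto_iff_norm_sub_tendsto_zero]
    have h2 : ∀ e : A, ‖indicatorConstLp (μ := ν) 1 hs hμs.ne (e * c) -
        indicatorConstLp 1 hs hμs.ne c‖ = ‖e * c - c‖ * ν.real s := by
      intro e
      rw [indicatorConstLp_sub, norm_indicatorConstLp (by simp) (by simp)]
      simp
    simp only [h2]
    have h3 := ((hl.tendsto_mul_right c).sub_const c).norm.mul_const (ν.real s)
    simpa using h3
  | add hf hg _ h1 h2 =>
    simp only [map_add]
    exact h1.add h2
  | isClosed =>
    rw [← isSeqClosed_iff_isClosed]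
    intro u x hu hx
    change Tendsto _ _ _
    rw [Metric.tendsto_nhds]
    intro ε hε
    obtain ⟨n, hn⟩ := ((Metric.tendsto_nhds.1 hx) (ε / 3) (by positivity)).exists
    filter_upwards [(Metric.tendsto_nhds.1 (hu n)) (ε / 3) (by positivity), hb] with e he1 he2
    rw [dist_eq_norm] at *
    have h4 := norm_leftMul_apply_le ν e (u n - x)
    have h5 : ‖leftMul ν e (u n - x)‖ ≤ ‖u n - x‖ :=
      h4.trans (mul_le_of_le_one_left (norm_nonneg _) he2)
    have h6 : leftMul ν e x - x
        = (leftMul ν e (u n) - u n) + (u n - x) - leftMul ν e (u n - x) := by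
      rw [map_sub]; abel
    rw [h6]
    calc _ ≤ ‖leftMul ν e (u n) - u n‖ + ‖u n - x‖ + ‖leftMul ν e (u n - x)‖ :=
          (norm_sub_le _ _).trans (add_le_add_left (norm_add_le _ _) _)
      _ < ε := by linarith

end Centralizers

/-! ### Twisted translations and convolution as a Bochner integral -/

section Translate

variable {G A : Type*} [Group G] [TopologicalSpace G] [IsTopologicalGroup G]
  [MeasurableSpace G] [BorelSpace G]
  [NonUnitalNormedRing A] [NormedSpace ℂ A]

/-- The twisted left translation `(translate h x)(g) = α_h(x(h⁻¹ g))` on `L^1(G, A)`. -/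
def translate (α : IsometricAction G A) (ν : Measure G) [ν.IsHaarMeasure] (h : G) :
    Lp A 1 ν →L[ℂ] Lp A 1 ν :=
  (α.linearIsometry h).toContinuousLinearMap.compLpL 1 ν ∘L
    (Lp.compMeasurePreservingₗᵢ ℂ (h⁻¹ * ·)
      (measurePreserving_mul_left ν h⁻¹)).toContinuousLinearMap

variable (α : IsometricAction G A) (ν : Measure G) [ν.IsHaarMeasure]

theorem coeFn_translate (h : G) (x : Lp A 1 ν) :
    translate α ν h x =ᵐ[ν] fun g => α h (x (h⁻¹ * g)) := by
  have h1 := (α.linearIsometry h).toContinuousLinearMap.coeFn_compLp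
    (Lp.compMeasurePreserving (h⁻¹ * ·) (measurePreserving_mul_left ν h⁻¹) x)
  filter_upwards [h1, Lp.coeFn_compMeasurePreserving x (measurePreserving_mul_left ν h⁻¹)]
    with g h2 h3
  refine h2.trans ?_
  rw [h3]
  rfl

theorem norm_translate_le (h : G) : ‖translate α ν h‖ ≤ 1 := by
  refine (ContinuousLinearMap.opNorm_comp_le _ _).trans ?_
  exact mul_le_one₀ (((α.linearIsometry h).toContinuousLinearMap.norm_compLpL_le).trans
    (LinearIsometry.norm_toContinuousLinearMap_le _)) (norm_nonneg _)
    (LinearIsometry.norm_toContinuousLinearMap_le _)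

theorem norm_translate_apply_le (h : G) (x : Lp A 1 ν) : ‖translate α ν h x‖ ≤ ‖x‖ := by
  simpa using (translate α ν h).le_of_opNorm_le (norm_translate_le α ν h) x

theorem translate_one (x : Lp A 1 ν) : translate α ν 1 x = x := by
  apply Lp.ext
  filter_upwards [coeFn_translate α ν 1 x] with g h1
  rw [h1]
  simp [α.map_one]

theorem translate_mul (g h : G) (x : Lp A 1 ν) :
    translate α ν (g * h) x = translate α ν g (translate α ν h x) := by
  apply Lp.ext
  have h3 := (measurePreserving_mul_left ν g⁻¹).quasiMeasurePreserving.ae (coeFn_translate α ν h x)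
  filter_upwards [coeFn_translate α ν (g * h) x, coeFn_translate α ν g (translate α ν h x), h3]
    with s h1 h2 h3
  rw [h1, h2, h3, α.map_mul]
  simp [mul_assoc]

theorem translate_leftMul [IsScalarTower ℂ A A] [SMulCommClass ℂ A A]
    (h : G) (a : A) (x : Lp A 1 ν) :
    translate α ν h (leftMul ν a x) = leftMul ν (α h a) (translate α ν h x) := by
  apply Lp.ext
  have h3 := (measurePreserving_mul_left ν h⁻¹).quasiMeasurePreserving.ae (coeFn_leftMul ν a x)
  filter_upwards [coeFn_translate α ν h (leftMul ν a x), coeFn_translate α ν h x,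
    coeFn_leftMul ν (α h a) (translate α ν h x), h3] with g h1 h2 h4 h3
  rw [h1, h3, h4, h2, map_mul]

variable [LocallyCompactSpace G] [SecondCountableTopology G] [T2Space G]

/-- Plain translation `τ` is continuous in `L^1`. The pointwise action `β` is strongly continuous by
dominated convergence and nonexpansive, so the two compose. -/
theorem continuous_translate (x : Lp A 1 ν) : Continuous fun h => translate α ν h x := by
  let τ : G → Lp A 1 ν := fun h =>
    Lp.compMeasurePreserving (h⁻¹ * ·) (measurePreserving_mul_left ν h⁻¹) x
  have hτ : Continuous τ := by
    -- Currying gives continuity of `h ↦ (h⁻¹ * ·)` in the compact-open topology.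
    let m : C(G × G, G) := ⟨fun q => q.1⁻¹ * q.2, by fun_prop⟩
    exact (continuous_const (y := x)).compMeasurePreservingLp m.curry.continuous
      (fun h => measurePreserving_mul_left ν h⁻¹) (by simp)
  let β : G → Lp A 1 ν → Lp A 1 ν := fun h y =>
    (α.linearIsometry h).toContinuousLinearMap.compLpL 1 ν y
  have hβ1 : ∀ h y z, ‖β h y - β h z‖ ≤ ‖y - z‖ := fun h y z => by
    simp only [β]
    rw [← map_sub]
    simpa using ContinuousLinearMap.le_of_opNorm_le _
      (((α.linearIsometry h).toContinuousLinearMap.norm_compLpL_le).trans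
      (LinearIsometry.norm_toContinuousLinearMap_le _)) (y - z)
  have hcoe : ∀ h y, β h y =ᵐ[ν] fun g => α h (y g) := fun h y =>
    (α.linearIsometry h).toContinuousLinearMap.coeFn_compLp y
  have hβ2 : ∀ y h₀, Tendsto (fun h => β h y) (𝓝 h₀) (𝓝 (β h₀ y)) := by
    intro y h₀
    rw [tendsto_iff_norm_sub_tendsto_zero]
    have hy : Integrable y ν := L1.integrable_coeFn y
    have h1 : ∀ h, ‖β h y - β h₀ y‖ = ∫ g, ‖α h (y g) - α h₀ (y g)‖ ∂ν := by
      intro h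
      rw [L1.norm_eq_integral_norm]
      refine integral_congr_ae ?_
      filter_upwards [hcoe h y, hcoe h₀ y, Lp.coeFn_sub (β h y) (β h₀ y)] with g e1 e2 e3
      rw [e3, Pi.sub_apply, e1, e2]
    simp only [h1]
    have h2 : (0 : ℝ) = ∫ g, (0 : ℝ) ∂ν := by simp
    rw [h2]
    refine tendsto_integral_filter_of_dominated_convergence (fun g => 2 * ‖y g‖) ?_ ?_
      (hy.norm.const_mul 2) ?_
    · refine Eventually.of_forall fun h => ?_
      exact (((α.linearIsometry h).continuous.comp_aestronglyMeasurable
        hy.aestronglyMeasurable).sub ((α.linearIsometry h₀).continuous.comp_aestronglyMeasurable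
        hy.aestronglyMeasurable)).norm
    · refine Eventually.of_forall fun h => Eventually.of_forall fun g => ?_
      rw [norm_norm]
      refine (norm_sub_le _ _).trans ?_
      rw [α.norm_map, α.norm_map, two_mul]
    · refine Eventually.of_forall fun g => ?_
      have := (((α.continuous_orbit (y g)).tendsto h₀).sub_const (α h₀ (y g))).norm
      simpa using this
  rw [continuous_iff_continuousAt]
  intro h₀
  change Tendsto (fun h => β h (τ h)) (𝓝 h₀) (𝓝 (β h₀ (τ h₀)))
  have h1 : Tendsto (fun h => β h (τ h) - β h (τ h₀)) (𝓝 h₀) (𝓝 0) := by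
    refine squeeze_zero_norm (fun h => hβ1 h _ _) ?_
    simpa using ((hτ.tendsto h₀).sub_const (τ h₀)).norm
  simpa using h1.add (hβ2 (τ h₀) h₀)

variable [IsScalarTower ℂ A A] [SMulCommClass ℂ A A]

theorem integrable_leftMul_translate (x y : Lp A 1 ν) :
    Integrable (fun h => leftMul ν (x h) (translate α ν h y)) ν := by
  have hx : Integrable x ν := L1.integrable_coeFn x
  have hτ : AEStronglyMeasurable (fun h => translate α ν h y) ν :=
    (continuous_translate α ν y).aestronglyMeasurable
  have hL : AEStronglyMeasurable (fun h => leftMul ν (x h)) ν :=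
    (leftMul ν).continuous.comp_aestronglyMeasurable hx.aestronglyMeasurable
  have hm : AEStronglyMeasurable (fun h => leftMul ν (x h) (translate α ν h y)) ν :=
    isBoundedBilinearMap_apply.continuous.comp_aestronglyMeasurable (hL.prodMk hτ)
  refine (hx.norm.mul_const ‖y‖).mono' hm (Eventually.of_forall fun h => ?_)
  exact (norm_leftMul_apply_le ν _ _).trans
    (mul_le_mul_of_nonneg_left (norm_translate_apply_le α ν h y) (norm_nonneg (x h)))

/-- The twisted convolution is a Bochner integral in `L^1(G, A)`. -/
theorem twistedConv_eq_integral [CompleteSpace A] (x y : Lp A 1 ν) :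
    twistedConv α ν x y = ∫ h, leftMul ν (x h) (translate α ν h y) ∂ν := by
  apply Lp.ext
  refine Integrable.ae_eq_of_forall_setIntegral_eq _ _ (L1.integrable_coeFn _)
    (L1.integrable_coeFn _) fun s hs _ => ?_
  -- Set integrals determine an `L^1` function. As `S` is continuous and linear it commutes with the
  -- Bochner integral, and the claim becomes Fubini on `s × G`.
  let S : Lp A 1 ν →L[ℂ] A :=
    { toFun := fun f => ∫ g in s, f g ∂ν
      map_add' := fun f g => by
        rw [← integral_add (L1.integrable_coeFn f).integrableOn
          (L1.integrable_coeFn g).integrableOn]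
        exact integral_congr_ae (ae_restrict_of_ae (Lp.coeFn_add f g))
      map_smul' := fun c f => by
        rw [RingHom.id_apply, ← integral_smul]
        exact integral_congr_ae (ae_restrict_of_ae (Lp.coeFn_smul c f))
      cont := continuous_setIntegral s }
  have h1 := S.integral_comp_comm (integrable_leftMul_translate α ν x y)
  have h2 : ∀ h, S (leftMul ν (x h) (translate α ν h y)) =
      ∫ g in s, x h * α h (y (h⁻¹ * g)) ∂ν := by
    intro h
    refine integral_congr_ae (ae_restrict_of_ae ?_)
    filter_upwards [coeFn_leftMul ν (x h) (translate α ν h y), coeFn_translate α ν h y]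
      with g e1 e2
    rw [e1, e2]
  simp only [h2] at h1
  refine Eq.trans ?_ h1
  rw [integral_congr_ae (ae_restrict_of_ae (coeFn_twistedConv α ν x y))]
  refine integral_integral_swap (f := fun g h => x h * α h (y (h⁻¹ * g))) ?_
  refine (integrable_twistedIntegrand α ν x y).mono_measure ?_
  exact Measure.prod_mono Measure.restrict_le_self le_rfl

theorem leftMul_twistedConv [CompleteSpace A] (a : A) (x y : Lp A 1 ν) :
    leftMul ν a (twistedConv α ν x y) = twistedConv α ν (leftMul ν a x) y := by
  rw [twistedConv_eq_integral, twistedConv_eq_integral,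
    ← (leftMul ν a).integral_comp_comm (integrable_leftMul_translate α ν x y)]
  refine integral_congr_ae ?_
  filter_upwards [coeFn_leftMul ν a x] with h e
  rw [e, leftMul_mul]

/-- Left invariance of `ν` allows the substitution `h ↦ k⁻¹ h`, which moves the translation from the
product onto its first factor. -/
theorem translate_twistedConv [CompleteSpace A] (k : G) (x y : Lp A 1 ν) :
    translate α ν k (twistedConv α ν x y) = twistedConv α ν (translate α ν k x) y := by
  rw [twistedConv_eq_integral, twistedConv_eq_integral,
    ← (translate α ν k).integral_comp_comm (integrable_leftMul_translate α ν x y),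
    ← integral_mul_left_eq_self _ k⁻¹]
  refine integral_congr_ae ?_
  filter_upwards [coeFn_translate α ν k x] with h e
  rw [e, translate_leftMul, ← translate_mul, mul_inv_cancel_left]

end Translate

/-! ### Extending centralizers along a nondegenerate representation -/

section Extension

variable {ι E : Type*} [NormedAddCommGroup E] [NormedSpace ℂ E]

theorem exists_limit_of_dense [CompleteSpace E] {F : Filter ι} [F.NeBot] {g : ι → E →L[ℂ] E}
    {C : ℝ} (hC : 0 ≤ C) (hg : ∀ᶠ i in F, ‖g i‖ ≤ C) {D : Set E} (hD : Dense D)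
    (hlim : ∀ η ∈ D, ∃ l, Tendsto (fun i => g i η) F (𝓝 l)) :
    ∃ S : E →L[ℂ] E, ‖S‖ ≤ C ∧ ∀ ξ, Tendsto (fun i => g i ξ) F (𝓝 (S ξ)) := by
  have hall : ∀ ξ, ∃ l, Tendsto (fun i => g i ξ) F (𝓝 l) := by
    intro ξ
    rw [← cauchy_map_iff_exists_tendsto, Metric.cauchy_iff]
    refine ⟨inferInstance, fun ε hε => ?_⟩
    -- Then `‖g i (ξ - η)‖ < ε / 4`; using `C + 1` avoids dividing by zero when `C = 0`.
    obtain ⟨η, hη, hd⟩ := hD.exists_dist_lt ξ (ε := ε / (4 * (C + 1))) (by positivity)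
    obtain ⟨l, hl⟩ := hlim η hη
    refine ⟨Metric.ball l (ε / 2), ?_, fun a ha b hb => ?_⟩
    · rw [mem_map]
      filter_upwards [hg, Metric.tendsto_nhds.1 hl (ε / 4) (by positivity)] with i h1 h2
      rw [Set.mem_preimage, Metric.mem_ball]
      rw [dist_eq_norm] at h2 hd ⊢
      have h3 : ‖g i (ξ - η)‖ ≤ C * ‖ξ - η‖ := (g i).le_of_opNorm_le h1 _
      rw [lt_div_iff₀ (by positivity)] at hd
      have h4 : g i ξ - l = g i (ξ - η) + (g i η - l) := by rw [map_sub]; abel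
      rw [h4]
      refine (norm_add_le _ _).trans_lt ?_
      nlinarith [norm_nonneg (ξ - η)]
    · linarith [dist_triangle_right a b l, Metric.mem_ball.1 ha, Metric.mem_ball.1 hb]
  choose f hf using hall
  let S₀ : E →ₗ[ℂ] E := linearMapOfTendsto f (fun i => (g i : E →ₗ[ℂ] E)) (tendsto_pi_nhds.2 hf)
  have hbd : ∀ ξ, ‖S₀ ξ‖ ≤ C * ‖ξ‖ := fun ξ =>
    le_of_tendsto (hf ξ).norm (hg.mono fun i hi => (g i).le_of_opNorm_le hi ξ)
  exact ⟨S₀.mkContinuous C hbd, LinearMap.mkContinuous_norm_le _ hC _, hf⟩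

theorem IsNondegenerateFamily.ext {T : ι → E →L[ℂ] E} (hT : IsNondegenerateFamily T)
    {S S' : E →L[ℂ] E} (h : ∀ i ξ, S (T i ξ) = S' (T i ξ)) : S = S' := by
  refine ContinuousLinearMap.ext_on hT ?_
  rintro _ ⟨i, ξ, rfl⟩
  exact h i ξ

variable {X : Type*} [NormedAddCommGroup X] [NormedSpace ℂ X]

/-- A left centralizer `T` of a normed algebra `X` with a contractive left approximate identity
extends along every nondegenerate contractive representation of `X`. -/
theorem exists_extension_of_centralizer [CompleteSpace E] {F : Filter ι} [F.NeBot] {e : ι → X}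
    (he : ∀ᶠ i in F, ‖e i‖ ≤ 1) {m : X → X → X}
    (hm : ∀ x, Tendsto (fun i => m (e i) x) F (𝓝 x))
    {π : X →ₗ[ℂ] (E →L[ℂ] E)} (hmul : ∀ x y, π (m x y) = π x * π y)
    (hcontr : ∀ x, ‖π x‖ ≤ ‖x‖) (hnondeg : IsNondegenerateFamily π)
    (T : X →L[ℂ] X) (hT : ∀ x y, T (m x y) = m (T x) y) :
    ∃ S : E →L[ℂ] E, ‖S‖ ≤ ‖T‖ ∧ ∀ x ξ, S (π x ξ) = π (T x) ξ := by
  have hπ : Continuous π := (π.mkContinuous 1 (by simpa using hcontr)).continuous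
  -- The centralizer identity gives `π (T e_i) π x = π (T (e_i * x))`, and `e_i * x → x`.
  have hlim : ∀ x ξ, Tendsto (fun i => π (T (e i)) (π x ξ)) F (𝓝 (π (T x) ξ)) := by
    intro x ξ
    have h1 : Tendsto (fun i => π (T (m (e i) x)) ξ) F (𝓝 (π (T x) ξ)) := by
      have h2 : Continuous fun y => π (T y) ξ := (hπ.comp T.continuous).clm_apply continuous_const
      exact (h2.tendsto x).comp (hm x)
    simpa only [hT, hmul, mul_apply_eq_comp] using h1
  obtain ⟨S, hS, hSlim⟩ := exists_limit_of_dense (F := F) (g := fun i => π (T (e i)))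
    (norm_nonneg T) (he.mono fun i hi => (hcontr _).trans
      ((T.le_opNorm _).trans (mul_le_of_le_one_right (norm_nonneg _) hi))) hnondeg (by
    intro η hη
    induction hη using Submodule.span_induction with
    | mem η hη =>
      obtain ⟨x, ξ, rfl⟩ := hη
      exact ⟨_, hlim x ξ⟩
    | zero => exact ⟨0, by simp⟩
    | add η ζ _ _ h1 h2 =>
      obtain ⟨l, hl⟩ := h1
      obtain ⟨k, hk⟩ := h2
      exact ⟨l + k, by simpa using hl.add hk⟩
    | smul c η _ h =>
      obtain ⟨l, hl⟩ := h
      exact ⟨c • l, by simpa using hl.const_smul c⟩)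
  exact ⟨S, hS, fun x ξ => tendsto_nhds_unique (hSlim _) (hlim x ξ)⟩

end Extension

/-! ### Approximate identity and disintegration -/

section Disintegration

variable {G A : Type*} [Group G] [TopologicalSpace G] [IsTopologicalGroup G]
  [LocallyCompactSpace G] [SecondCountableTopology G] [T2Space G]
  [MeasurableSpace G] [BorelSpace G]
  [NonUnitalNormedRing A] [NormedSpace ℂ A] [IsScalarTower ℂ A A] [SMulCommClass ℂ A A]
  [CompleteSpace A]

/-- `L^1(G, A, α)` has a contractive left approximate identity. -/
theorem exists_left_approxIdentity (hcai : HasContractiveApproxIdentity A)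
    (α : IsometricAction G A) (ν : Measure G) [ν.IsHaarMeasure] :
    ∃ (F : Filter (ℕ × A)) (_ : F.NeBot) (e : ℕ × A → Lp A 1 ν), (∀ᶠ i in F, ‖e i‖ ≤ 1) ∧
      ∀ x, Tendsto (fun i => twistedConv α ν (e i) x) F (𝓝 x) := by
  obtain ⟨l, hl, hb⟩ := hcai
  have := hl.neBot
  obtain ⟨B, hB⟩ := (𝓝 (1 : G)).exists_antitone_basis
  have hex : ∀ n, ∃ U ⊆ B n, IsOpen U ∧ (1 : G) ∈ U ∧ ν U ≠ ⊤ := by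
    intro n
    obtain ⟨V, hV, hVo, hVν⟩ := ν.exists_isOpen_measure_lt_top (1 : G)
    obtain ⟨W, hWB, hWo, hW1⟩ := mem_nhds_iff.1 (hB.mem n)
    exact ⟨W ∩ V, Set.inter_subset_left.trans hWB, hWo.inter hVo, ⟨hW1, hV⟩,
      ((measure_mono Set.inter_subset_right).trans_lt hVν).ne⟩
  choose U hUB hUo hU1 hUν using hex
  have hpos : ∀ n, 0 < ν.real (U n) := fun n =>
    ENNReal.toReal_pos ((hUo n).measure_pos ν ⟨1, hU1 n⟩).ne' (hUν n)
  -- Normalized indicators of neighbourhoods shrinking to `1`, with values in the approximate unit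
  -- of `A`; the two indices tend to their limits independently.
  let e : ℕ × A → Lp A 1 ν := fun i =>
    indicatorConstLp 1 (hUo i.1).measurableSet (hUν i.1) (((ν.real (U i.1) : ℂ))⁻¹ • i.2)
  refine ⟨atTop ×ˢ l, inferInstance, e, ?_, fun x => ?_⟩
  · filter_upwards [tendsto_snd.eventually hb] with i hi
    rw [norm_indicatorConstLp (by simp) (by simp), norm_smul]
    simp only [norm_inv, Complex.norm_real, Real.norm_of_nonneg (hpos i.1).le, ENNReal.toReal_one,
      div_one, Real.rpow_one]
    rw [mul_right_comm, inv_mul_cancel₀ (hpos i.1).ne', one_mul]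
    exact hi
  -- The error is an average over `U n`, so a bound on the integrand uniform in `h ∈ U n` suffices.
  · have hconv : ∀ i, twistedConv α ν (e i) x - x = (ν.real (U i.1) : ℂ)⁻¹ •
        ∫ h in U i.1, (leftMul ν i.2 (translate α ν h x) - x) ∂ν := by
      rintro ⟨n, a⟩
      have hc : (ν.real (U n) : ℂ) ≠ 0 := by exact_mod_cast (hpos n).ne'
      have hcont : Continuous fun h => leftMul ν a (translate α ν h x) :=
        (leftMul ν a).continuous.comp (continuous_translate α ν x)
      have hint : IntegrableOn (fun h => leftMul ν a (translate α ν h x)) (U n) ν := by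
        refine IntegrableOn.of_bound (hUν n).lt_top hcont.aestronglyMeasurable (‖a‖ * ‖x‖)
          (Eventually.of_forall fun h => ?_)
        exact (norm_leftMul_apply_le ν _ _).trans
          (mul_le_mul_of_nonneg_left (norm_translate_apply_le α ν h x) (norm_nonneg a))
      have hreal : ν.real (U n) • x = (ν.real (U n) : ℂ) • x :=
        (IsScalarTower.algebraMap_smul ℂ (ν.real (U n)) x).symm
      rw [integral_sub hint (integrableOn_const (hUν n)), setIntegral_const, smul_sub,
        hreal, inv_smul_smul₀ hc, ← integral_smul, twistedConv_eq_integral,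
        ← integral_indicator (hUo n).measurableSet]
      congr 1
      refine integral_congr_ae ?_
      filter_upwards [indicatorConstLp_coeFn (p := 1) (hs := (hUo n).measurableSet)
        (hμs := hUν n) (c := (ν.real (U n) : ℂ)⁻¹ • a)] with h hh
      simp only [e]
      rw [hh]
      by_cases hn : h ∈ U n <;> simp [hn]
    rw [Metric.tendsto_nhds]
    intro ε hε
    have h1 : ∀ᶠ n in atTop, ∀ h ∈ U n, ‖translate α ν h x - x‖ < ε / 3 := by
      have h2 : ∀ᶠ h in 𝓝 (1 : G), ‖translate α ν h x - x‖ < ε / 3 := by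
        have h3 := (continuous_translate α ν x).tendsto 1
        rw [translate_one] at h3
        simpa only [dist_eq_norm] using Metric.tendsto_nhds.1 h3 (ε / 3) (by positivity)
      obtain ⟨N, -, hN⟩ := hB.1.mem_iff.1 h2
      filter_upwards [eventually_ge_atTop N] with n hn h hh
      exact hN (hB.2 hn (hUB n hh))
    filter_upwards [tendsto_fst.eventually h1, tendsto_snd.eventually hb, tendsto_snd.eventually
      (Metric.tendsto_nhds.1 (tendsto_leftMul hl hb x) (ε / 3) (by positivity))] with i h1 h2 h3
    rw [dist_eq_norm] at *
    rw [hconv, norm_smul, norm_inv, Complex.norm_real, Real.norm_of_nonneg (hpos i.1).le,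
      inv_mul_lt_iff₀ (hpos i.1)]
    have h4 : ∀ h ∈ U i.1, ‖leftMul ν i.2 (translate α ν h x) - x‖ ≤ 2 * (ε / 3) := by
      intro h hh
      have h5 : leftMul ν i.2 (translate α ν h x) - x =
          leftMul ν i.2 (translate α ν h x - x) + (leftMul ν i.2 x - x) := by
        rw [map_sub]; abel
      have h6 : ‖leftMul ν i.2 (translate α ν h x - x)‖ ≤ ‖translate α ν h x - x‖ :=
        (norm_leftMul_apply_le ν _ _).trans (mul_le_of_le_one_left (norm_nonneg _) h2)
      rw [h5]
      linarith [norm_add_le (leftMul ν i.2 (translate α ν h x - x)) (leftMul ν i.2 x - x), h1 h hh]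
    refine (norm_setIntegral_le_of_norm_le_const (hUν i.1).lt_top h4).trans_lt ?_
    nlinarith [hpos i.1]

variable {E : Type*} [NormedAddCommGroup E] [NormedSpace ℂ E] [CompleteSpace E]

/-- Every nondegenerate contractive representation of `L^1(G, A, α)` induces a contractive
covariant representation of `(G, A, α)`. -/
theorem exists_covariantRep (hcai : HasContractiveApproxIdentity A) (α : IsometricAction G A)
    (ν : Measure G) [ν.IsHaarMeasure] {π : Lp A 1 ν →ₗ[ℂ] (E →L[ℂ] E)}
    (hmul : ∀ x y, π (twistedConv α ν x y) = π x * π y) (hcontr : ∀ x, ‖π x‖ ≤ ‖x‖)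
    (hnondeg : IsNondegenerateFamily π) :
    ∃ R : CovariantRep α E, R.IsContractive ∧
      (∀ a x ξ, R.rep a (π x ξ) = π (leftMul ν a x) ξ) ∧
      ∀ g x ξ, (R.grp g : E →L[ℂ] E) (π x ξ) = π (translate α ν g x) ξ := by
  obtain ⟨F, _, e, he, hm⟩ := exists_left_approxIdentity hcai α ν
  choose ρ hρn hρ using fun a : A => exists_extension_of_centralizer he hm hmul hcontr hnondeg
    (leftMul ν a) (leftMul_twistedConv α ν a)
  choose u hun hu using fun g : G => exists_extension_of_centralizer he hm hmul hcontr hnondeg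
    (translate α ν g) (translate_twistedConv α ν g)
  have hρn' : ∀ a, ‖ρ a‖ ≤ ‖a‖ := fun a => (hρn a).trans (norm_leftMul_le ν a)
  have hun' : ∀ g, ‖u g‖ ≤ 1 := fun g => (hun g).trans (norm_translate_le α ν g)
  have hadd : ∀ a b, ρ (a + b) = ρ a + ρ b := fun a b => hnondeg.ext fun x ξ => by
    simp [hρ]
  let r : A →ₙₐ[ℂ] (E →L[ℂ] E) :=
    { toFun := ρ
      map_smul' := fun c a => hnondeg.ext fun x ξ => by simp [hρ]
      map_zero' := hnondeg.ext fun x ξ => by simp [hρ]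
      map_add' := hadd
      map_mul' := fun a b => hnondeg.ext fun x ξ => by simp [hρ, leftMul_mul] }
  let v : G →* (E →L[ℂ] E) :=
    { toFun := u
      map_one' := hnondeg.ext fun x ξ => by simp [hu, translate_one]
      map_mul' := fun g h => hnondeg.ext fun x ξ => by simp [hu, translate_mul] }
  have hr : Continuous r :=
    (LinearMap.mkContinuous (r : A →ₗ[ℂ] (E →L[ℂ] E)) 1 (by simpa using! hρn')).continuous
  have hπ : Continuous π := (π.mkContinuous 1 (by simpa using hcontr)).continuous
  have hv : ∀ ξ, Continuous fun g => v g ξ := by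
    intro ξ
    have hcl : ξ ∈ closure (Submodule.span ℂ {η : E | ∃ x ξ, π x ξ = η} : Set E) := hnondeg ξ
    rw [continuous_iff_continuousAt]
    intro g₀
    rw [ContinuousAt, Metric.tendsto_nhds]
    intro ε hε
    obtain ⟨η, hη, hd⟩ := Metric.mem_closure_iff.1 hcl (ε / 3) (by positivity)
    -- Orbits of vectors in the span are continuous because translation is; `‖u g‖ ≤ 1` then extends
    -- this to `ξ`.
    have hc : Continuous fun g => v g η := by
      clear hd
      induction hη using Submodule.span_induction with
      | mem η hη =>
        obtain ⟨x, ζ, rfl⟩ := hη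
        have h1 : (fun g => v g (π x ζ)) = fun g => π (translate α ν g x) ζ :=
          funext fun g => hu g x ζ
        rw [h1]
        exact (hπ.comp (continuous_translate α ν x)).clm_apply continuous_const
      | zero => simpa using continuous_const
      | add η ζ _ _ h1 h2 => simpa only [map_add] using! h1.add h2
      | smul c η _ h => simpa only [map_smul] using! h.const_smul c
    filter_upwards [Metric.tendsto_nhds.1 (hc.tendsto g₀) (ε / 3) (by positivity)] with g hg
    have h1 : ∀ g, dist (v g ξ) (v g η) ≤ dist ξ η := fun g => by
      rw [dist_eq_norm, dist_eq_norm, ← map_sub]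
      simpa using (v g).le_of_opNorm_le (hun' g) (ξ - η)
    have h2 := dist_triangle4 (v g ξ) (v g η) (v g₀ η) (v g₀ ξ)
    linarith [h1 g, h1 g₀, dist_comm (v g₀ η) (v g₀ ξ)]
  refine ⟨{ rep := r
            continuous_rep := hr
            grp := v.toHomUnits
            continuous_grp := hv
            covariant := fun g a => ?_ }, ⟨hρn', hun'⟩, hρ, hu⟩
  -- Covariance reduces to `translate g ∘ leftMul a ∘ translate g⁻¹ = leftMul (α g a)` on `L^1(G,
  -- A)`.
  rw [← map_inv]
  refine hnondeg.ext fun x ξ => ?_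
  change ρ (α g a) (π x ξ) = u g (ρ a (u g⁻¹ (π x ξ)))
  rw [hρ, hu, hρ, hu, translate_leftMul, ← translate_mul, mul_inv_cancel, translate_one]

/-- Disintegration of nondegenerate contractive representations of `L^1(G, A, α)`. -/
theorem exists_integrated_eq (hcai : HasContractiveApproxIdentity A) (α : IsometricAction G A)
    (ν : Measure G) [ν.IsHaarMeasure] {π : Lp A 1 ν →ₗ[ℂ] (E →L[ℂ] E)}
    (hmul : ∀ x y, π (twistedConv α ν x y) = π x * π y) (hcontr : ∀ x, ‖π x‖ ≤ ‖x‖)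
    (hnondeg : IsNondegenerateFamily π) :
    ∃ (R : CovariantRep α E) (hR : R.IsContractive),
      R.IsNondegenerate ∧ ∀ x, R.integrated hR ν x = π x := by
  obtain ⟨R, hR, hrep, hgrp⟩ := exists_covariantRep hcai α ν hmul hcontr hnondeg
  have hπ : Continuous π := (π.mkContinuous 1 (by simpa using hcontr)).continuous
  refine ⟨R, hR, ?_, fun x => hnondeg.ext fun y ξ => ?_⟩
  · obtain ⟨l, hl, hb⟩ := hcai
    have := hl.neBot
    -- Each `π x ξ` is the limit of `R.rep a (π x ξ)` along the approximate unit, hence lies in `N`.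
    let N : Submodule ℂ E := (Submodule.span ℂ {η : E | ∃ a ξ, R.rep a ξ = η}).topologicalClosure
    have hle : Submodule.span ℂ {η : E | ∃ x ξ, π x ξ = η} ≤ N := by
      refine Submodule.span_le.2 ?_
      rintro _ ⟨x, ξ, rfl⟩
      have hc : Continuous fun y => π y ξ := hπ.clm_apply continuous_const
      have h1 : Tendsto (fun a => R.rep a (π x ξ)) l (𝓝 (π x ξ)) := by
        simp only [hrep]
        exact (hc.tendsto x).comp (tendsto_leftMul hl hb x)
      exact mem_closure_of_tendsto h1 (Eventually.of_forall fun a =>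
        Submodule.subset_span ⟨a, _, rfl⟩)
    exact dense_closure.1 (hnondeg.mono hle)
  -- Evaluation of `π` at `ξ` as a bounded map, so that it moves inside the integral for `x * y`.
  · let L : Lp A 1 ν →L[ℂ] E :=
      (ContinuousLinearMap.apply ℂ E ξ) ∘L (π.mkContinuous 1 (by simpa using hcontr))
    have hL : ∀ z, L z = π z ξ := fun z => rfl
    rw [CovariantRep.integrated_apply, ← mul_apply_eq_comp, ← hmul,
      twistedConv_eq_integral, ← hL (∫ h, _ ∂ν),
      ← L.integral_comp_comm (integrable_leftMul_translate α ν x y)]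
    simp only [hL, hgrp, hrep]

end Disintegration

end LpCrossed

end

/-! ### Domination by the crossed product norm -/

theorem mainTheorem9 (p : ENNReal) [Fact (1 ≤ p)] (hp : p ≠ ⊤)
    {G : Type u} [Group G] [TopologicalSpace G] [IsTopologicalGroup G]
    [LocallyCompactSpace G] [SecondCountableTopology G] [T2Space G]
    [MeasurableSpace G] [BorelSpace G]
    (ν : Measure G) [ν.IsHaarMeasure]
    {A : Type v} [NonUnitalNormedRing A] [NormedSpace ℂ A] [IsScalarTower ℂ A A]
    [SMulCommClass ℂ A A] [CompleteSpace A]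
    (hA : LpCrossed.IsLpOperatorAlgebra.{w₀} p A)
    (hcai : LpCrossed.HasContractiveApproxIdentity A)
    (α : LpCrossed.IsometricAction G A)
    {Ω : Type w} [MeasurableSpace Ω] (μ : Measure Ω) [SigmaFinite μ]
    (π : Lp A 1 ν →ₗ[ℂ] (Lp ℂ p μ →L[ℂ] Lp ℂ p μ))
    (hmul : ∀ x y, π (LpCrossed.twistedConv α ν x y) = π x * π y)
    (hcontr : ∀ x, ‖π x‖ ≤ ‖x‖)
    (hnondeg : LpCrossed.IsNondegenerateFamily π)
    (x : Lp A 1 ν) :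
    ‖π x‖ ≤ LpCrossed.crossedNorm.{w} p α ν x := by
  obtain ⟨R, hR, hRn, hRπ⟩ := LpCrossed.exists_integrated_eq hcai α ν hmul hcontr hnondeg
  exact le_csSup (LpCrossed.bddAbove_crossedNormSet p α ν x)
    ⟨Ω, _, μ, inferInstance, R, hR, hRn, by rw [hRπ]⟩
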